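/- Let $\mathbb{G}=(C(\mathbb{G}),\Delta)$ be a compact quantum group: $C(\mathbb{G})$ is a nonzero unital $C^*$-algebra and $\Delta:C(\mathbb{G})\to C(\mathbb{G})\otimes_{\min}C(\mathbb{G})$ is a coassociative unital $*$-homomorphism such that $\{\Delta(a)(b\otimes 1)\}$ and $\{\Delta(a)(1\otimes b)\}$ each span a dense subspace. A representation is an invertible matrix $u=(u_{ij})\in M_n(C(\mathbb{G}))$ with $\Delta(u_{ij})=\sum_k u_{ik}\otimes u_{kj}$. Write $\mathrm{Hom}(u,v)=\{T: v(T\otimes 1)=(T\otimes 1)u\}$; $u$ and $v$ are equivalent if $\mathrm{Hom}(u,v)$ contains an invertible operator; $u\subseteq v$ means that $u\oplus w$ is equivalent to $v$ for some representation $w$; $u$ is irreducible if its space is nonzero and $\mathrm{Hom}(u,u)=\mathbb{C}\,\mathrm{Id}$; and $u\otimes v$ denotes the tensor product representation, with entries $u_{ij}v_{kl}$. Let $\alpha,\beta,\gamma$ be irreducible unitary representations of $\mathbb{G}$ on finite-dimensional Hilbert spaces $H_\alpha,H_\beta,H_\gamma$ with fixed orthonormal bases. For an irreducible unitary representation $u$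 let $u^c=(u_{ij}^*)$, let $Q_u$ be the positive invertible matrix, acting on the conjugate space $\overline{H_u}$, such that $\overline u=(Q_u^{1/2}\otimes 1)u^c(Q_u^{-1/2}\otimes 1)$ is unitary and $\mathrm{Tr}(Q_u)=\mathrm{Tr}(Q_u^{-1})$, and put $d_u=\mathrm{Tr}(Q_u)$. The quantum trace on $B(H_u)$ is $\mathrm{Tr}_{Q_u}(X)=\mathrm{Tr}(Q_u^{t}X)$, which is $\mathrm{Tr}(Q_uX)$ when the basis of $H_u$ is chosen so that $Q_u$ is diagonal. Suppose that $\overline\alpha\otimes\beta$ is equivalent to a direct sum of mutually inequivalent irreducible unitary representations and that $\overline\gamma\subseteq\overline\alpha\otimes\beta$. Then there is an isometric intertwiner $v\in\mathrm{Hom}(\alpha,\beta\otimes\gamma)$, and for every such $v$ the Clebsch–Gordan map $$\Phi^{\alpha\to\beta}_\gamma:B(H_\alpha)\to B(H_\beta),\qquad \Phi^{\alpha\to\beta}_\gamma(X)=(\mathrm{id}\otimes\mathrm{Tr}_{Q_\gamma})(vXv^*),$$ has the Choi–Jamiołkowski matrix $$\sum_{i,j}e_{ij}\otimes\Phi^{\alpha\to\beta}_\gamma(e_{ij})=\frac{d_\alpha}{d_\gamma}\,(Q_\alpha^{1/2}\otimes\mathrm{Id}_\beta)\;p^{\overline\alpha,\beta}_{\overline\gamma}\;(Q_\alpha^{1/2}\otimes\mathrm{Id}_\beta),$$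 where $e_{ij}$ are the matrix units of the fixed basis of $H_\alpha$ and $p^{\overline\alpha,\beta}_{\overline\gamma}$ is the orthogonal projection of $\overline{H_\alpha}\otimes H_\beta$ onto the $\overline\gamma$-component of $\overline\alpha\otimes\beta$, that is, onto the span of the ranges of all operators in $\mathrm{Hom}(\overline\gamma,\overline\alpha\otimes\beta)$. -/

import Mathlib

open scoped TensorProduct Kronecker MatrixOrder ComplexOrder

universe u

namespace CQG

noncomputable section

/-! ## Minimal tensor products of C*-algebras -/

/-- For linear maps `π : A → B(H)` and `ρ : B → B(K)`, the operator `(π ⊗ ρ)(x)` on the algebraic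
tensor product `H ⊗ K`, for `x` in the algebraic tensor product `A ⊗ B`. -/
def tensorAct {A B H K : Type u} [CStarAlgebra A] [CStarAlgebra B]
    [NormedAddCommGroup H] [InnerProductSpace ℂ H] [NormedAddCommGroup K] [InnerProductSpace ℂ K]
    (π : A →ₗ[ℂ] (H →L[ℂ] H)) (ρ : B →ₗ[ℂ] (K →L[ℂ] K)) (x : A ⊗[ℂ] B) :
    H ⊗[ℂ] K →ₗ[ℂ] H ⊗[ℂ] K :=
  TensorProduct.homTensorHomMap (RingHom.id ℂ) H K H K
    (TensorProduct.map ((ContinuousLinearMap.coeLM ℂ).comp π)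
      ((ContinuousLinearMap.coeLM ℂ).comp ρ) x)

/-- The minimal (spatial) C*-norm on the algebraic tensor product of two unital C*-algebras: the
supremum of the operator norms of `(π ⊗ ρ)(x)` over all unital `*`-representations `π` of `A` and
`ρ` of `B` on Hilbert spaces. -/
def minTensorNorm {A B : Type u} [CStarAlgebra A] [CStarAlgebra B] (x : A ⊗[ℂ] B) : ℝ :=
  sSup {r : ℝ | ∃ (H K : Type u)
    (_ : NormedAddCommGroup H) (_ : InnerProductSpace ℂ H) (_ : CompleteSpace H)
    (_ : NormedAddCommGroup K) (_ : InnerProductSpace ℂ K) (_ : CompleteSpace K)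
    (π : A →⋆ₐ[ℂ] (H →L[ℂ] H)) (ρ : B →⋆ₐ[ℂ] (K →L[ℂ] K)) (ξ : H ⊗[ℂ] K),
    ‖ξ‖ ≤ 1 ∧ r = ‖tensorAct π.toAlgHom.toLinearMap ρ.toAlgHom.toLinearMap x ξ‖}

/-- `T`, together with `ι`, is the minimal tensor product of `A` and `B`: the completion of the
algebraic tensor product in the minimal C*-norm. -/
structure IsMinTensorProduct {A B T : Type u} [CStarAlgebra A] [CStarAlgebra B] [CStarAlgebra T]
    (ι : A ⊗[ℂ] B →⋆ₐ[ℂ] T) : Prop where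
  norm_eq : ∀ x, ‖ι x‖ = minTensorNorm x
  dense : DenseRange ι

/-! ## Compact quantum groups -/

/-- A compact quantum group `𝔾` with `C(𝔾) = A`. The C*-algebras `A₂` and `A₃` are the minimal
tensor products `A ⊗ A` and `(A ⊗ A) ⊗ A`. The `*`-homomorphisms `comulId = Δ ⊗ id`,
`leg₂₃ : x ↦ 1 ⊗ x` and `idComul = id ⊗ Δ` from `A₂` to `A₃` are determined by their values on
elementary tensors. -/
structure CompactQuantumGroup (A : Type u) [CStarAlgebra A] where
  nontrivial : Nontrivial A
  A₂ : Type u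
  [cstar₂ : CStarAlgebra A₂]
  ι₂ : A ⊗[ℂ] A →⋆ₐ[ℂ] A₂
  isMin₂ : IsMinTensorProduct ι₂
  A₃ : Type u
  [cstar₃ : CStarAlgebra A₃]
  ι₃ : A₂ ⊗[ℂ] A →⋆ₐ[ℂ] A₃
  isMin₃ : IsMinTensorProduct ι₃
  /-- the comultiplication `Δ` -/
  comul : A →⋆ₐ[ℂ] A₂
  comulId : A₂ →⋆ₐ[ℂ] A₃
  comulId_tmul : ∀ a b : A, comulId (ι₂ (a ⊗ₜ b)) = ι₃ (comul a ⊗ₜ b)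
  leg₂₃ : A₂ →⋆ₐ[ℂ] A₃
  leg₂₃_tmul : ∀ a b : A, leg₂₃ (ι₂ (a ⊗ₜ b)) = ι₃ (ι₂ (1 ⊗ₜ a) ⊗ₜ b)
  idComul : A₂ →⋆ₐ[ℂ] A₃
  idComul_tmul : ∀ a b : A, idComul (ι₂ (a ⊗ₜ b)) = ι₃ (ι₂ (a ⊗ₜ 1) ⊗ₜ 1) * leg₂₃ (comul b)
  coassoc : ∀ a : A, comulId (comul a) = idComul (comul a)
  dense_left : Dense (Submodule.span ℂ
    {x : A₂ | ∃ a b : A, x = comul a * ι₂ (b ⊗ₜ 1)} : Set A₂)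
  dense_right : Dense (Submodule.span ℂ
    {x : A₂ | ∃ a b : A, x = comul a * ι₂ (1 ⊗ₜ b)} : Set A₂)

attribute [instance] CompactQuantumGroup.cstar₂ CompactQuantumGroup.cstar₃

/-! ## Representations -/

section Rep

variable {A : Type u} [CStarAlgebra A]
variable {m n : Type*} [Fintype m] [DecidableEq m] [Fintype n] [DecidableEq n]

/-- The scalar matrix `T ⊗ 1` with entries in `A`. -/
def scalarMat (A : Type u) [CStarAlgebra A] {m n : Type*} (T : Matrix m n ℂ) : Matrix m n A :=
  T.map (algebraMap ℂ A)

/-- A finite-dimensional representation of `𝔾`, as an invertible matrix over `C(𝔾)` with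
`Δ(u i j) = ∑ k, u i k ⊗ u k j`. -/
def CompactQuantumGroup.IsRep (G : CompactQuantumGroup A) (u : Matrix n n A) : Prop :=
  IsUnit u ∧ ∀ i j, G.comul (u i j) = ∑ k, G.ι₂ (u i k ⊗ₜ u k j)

/-- A finite-dimensional unitary representation. -/
def CompactQuantumGroup.IsUnitaryRep (G : CompactQuantumGroup A) (u : Matrix n n A) : Prop :=
  G.IsRep u ∧ u ∈ unitary (Matrix n n A)

/-- `Hom(u, v) = {T : v (T ⊗ 1) = (T ⊗ 1) u}`. -/
def Hom (u : Matrix n n A) (v : Matrix m m A) : Set (Matrix m n ℂ) :=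
  {T | v * scalarMat A T = scalarMat A T * u}

/-- Equivalence: there is an invertible intertwiner. -/
def Equivalent (u : Matrix n n A) (v : Matrix m m A) : Prop :=
  ∃ T ∈ Hom u v, ∃ S : Matrix n m ℂ, T * S = 1 ∧ S * T = 1

/-- An irreducible unitary representation (on a nonzero space): `Hom(u, u) = ℂ · Id`. -/
def CompactQuantumGroup.IsIrrep (G : CompactQuantumGroup A) (u : Matrix n n A) : Prop :=
  G.IsUnitaryRep u ∧ Nonempty n ∧ ∀ T ∈ Hom u u, ∃ c : ℂ, T = c • (1 : Matrix n n ℂ)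

/-- `u ⊆ v`: there is a representation `w` such that `u ⊕ w` is equivalent to `v`. -/
def CompactQuantumGroup.IsSubrep (G : CompactQuantumGroup A)
    (u : Matrix n n A) (v : Matrix m m A) : Prop :=
  ∃ (k : ℕ) (w : Matrix (Fin k) (Fin k) A), G.IsRep w ∧ Equivalent (Matrix.fromBlocks u 0 0 w) v

/-- `v` is equivalent to a direct sum of mutually inequivalent irreducible unitary
representations. -/
def CompactQuantumGroup.IsMultiplicityFree (G : CompactQuantumGroup A)
    (v : Matrix m m A) : Prop :=
  ∃ (N : ℕ) (d : Fin N → ℕ) (u : ∀ j, Matrix (Fin (d j)) (Fin (d j)) A),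
    (∀ j, G.IsIrrep (u j)) ∧ (∀ j k, j ≠ k → ¬ Equivalent (u j) (u k)) ∧
    Equivalent (Matrix.blockDiagonal' u) v

/-- The contragredient `u^c`, with entries `(u i j)^*`. -/
def contragredient (u : Matrix n n A) : Matrix n n A := u.map star

/-- `(Q^{1/2} ⊗ 1) u^c (Q^{-1/2} ⊗ 1)`; this is the conjugate representation of `u` when `Q = Q_u`
(see `IsQMatrix`). -/
def conjRep (u : Matrix n n A) (Q : Matrix n n ℂ) : Matrix n n A :=
  scalarMat A (CFC.sqrt Q) * contragredient u * scalarMat A ((CFC.sqrt Q)⁻¹)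

/-- `Q` is the matrix `Q_u` of the unitary representation `u`: it is positive and invertible, the
functionals `Tr (Q ·)` and `Tr (Q⁻¹ ·)` agree on the intertwiners of `u^c` (for irreducible `u` this
means `Tr Q = Tr Q⁻¹`), and `(Q^{1/2} ⊗ 1) u^c (Q^{-1/2} ⊗ 1)` is unitary. -/
structure IsQMatrix (u : Matrix n n A) (Q : Matrix n n ℂ) : Prop where
  posDef : Q.PosDef
  trace_eq : ∀ X ∈ Hom (contragredient u) (contragredient u), (Q * X).trace = (Q⁻¹ * X).trace
  unitary_conj : conjRep u Q ∈ unitary (Matrix n n A)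

/-- The tensor product of representations, with entries `u i j * v k l`. -/
def tensorRep (u : Matrix n n A) (v : Matrix m m A) : Matrix (n × m) (n × m) A :=
  Matrix.kroneckerMap (fun a b => a * b) u v

/-- `V` is an isometric intertwiner in `Hom(u, v)`. -/
def IsIsometricIntertwiner (u : Matrix n n A) (v : Matrix m m A) (V : Matrix m n ℂ) : Prop :=
  V ∈ Hom u v ∧ V.conjTranspose * V = 1

/-- The `u`-component of the representation space of `v`: the span of the ranges of all
intertwiners from `u` to `v`. -/
def component (u : Matrix n n A) (v : Matrix m m A) : Submodule ℂ (EuclideanSpace ℂ m) :=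
  Submodule.span ℂ {y | ∃ T ∈ Hom u v, ∃ x : n → ℂ, y = WithLp.toLp 2 (T.mulVec x)}

/-- The matrix of the orthogonal projection onto the `u`-component of `v`. -/
def componentProj (u : Matrix n n A) (v : Matrix m m A) : Matrix m m ℂ :=
  Matrix.toEuclideanLin.symm ((component u v).starProjection.toLinearMap)

end Rep

/-! ## Quantum traces, Clebsch-Gordan maps and Choi-Jamiołkowski matrices -/

section Maps

variable {l m n : Type*} [Fintype l] [DecidableEq l] [Fintype m] [DecidableEq m]
  [Fintype n] [DecidableEq n]

/-- The quantum dimension `Tr Q`. -/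
def quantumDim (Q : Matrix n n ℂ) : ℂ := Q.trace

/-- The quantum trace on `B(H_u)`. The matrix `Q = Q_u` is an operator on the conjugate space of
`H_u`; the operator on `H_u` that corresponds to it is its transpose. In an orthonormal basis that
diagonalizes `Q` this is `X ↦ Tr (Q X)`, see `quantumTrace_of_isDiag`. -/
def quantumTrace (Q : Matrix n n ℂ) : Matrix n n ℂ →ₗ[ℂ] ℂ where
  toFun X := (Q.transpose * X).trace
  map_add' X Y := by simp [Matrix.mul_add]
  map_smul' c X := by simp

theorem quantumTrace_of_isDiag (Q : Matrix n n ℂ) (hQ : Q.IsDiag) (X : Matrix n n ℂ) :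
    quantumTrace Q X = (Q * X).trace := by
  have h : Q.transpose = Q := hQ.isSymm
  simp [quantumTrace, h]

/-- The map `id ⊗ Tr_Q` from `B(H ⊗ K)` to `B(H)`. -/
def partialQuantumTrace (Q : Matrix n n ℂ) : Matrix (m × n) (m × n) ℂ →ₗ[ℂ] Matrix m m ℂ where
  toFun Y := Matrix.of fun b b' => quantumTrace Q (Matrix.of fun k k' => Y (b, k) (b', k'))
  map_add' X Y := by
    ext b b'
    exact map_add (quantumTrace Q) (Matrix.of fun k k' => X (b, k) (b', k'))
      (Matrix.of fun k k' => Y (b, k) (b', k'))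
  map_smul' c X := by
    ext b b'
    exact map_smul (quantumTrace Q) c (Matrix.of fun k k' => X (b, k) (b', k'))

/-- The Clebsch-Gordan map `X ↦ (id ⊗ Tr_Q)(V X V^*)`. -/
def cgMap (Q : Matrix n n ℂ) (V : Matrix (m × n) l ℂ) : Matrix l l ℂ →ₗ[ℂ] Matrix m m ℂ where
  toFun X := partialQuantumTrace Q (V * X * V.conjTranspose)
  map_add' X Y := by simp [Matrix.mul_add, Matrix.add_mul]
  map_smul' c X := by simp

/-- The Choi-Jamiołkowski matrix `∑ i j, e_ij ⊗ Φ(e_ij)`. -/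
def choiMatrix (Φ : Matrix l l ℂ →ₗ[ℂ] Matrix m m ℂ) : Matrix (l × m) (l × m) ℂ :=
  ∑ i, ∑ j, Matrix.single i j (1 : ℂ) ⊗ₖ Φ (Matrix.single i j 1)

end Maps

end

end CQG

set_option linter.unusedSectionVars false

/-! Write `Z` for the entries of `V*` regrouped as a map from `H_α ⊗ H_β` to `H_γ` (`rearrange`,
with the spaces of α and γ conjugated). The Choi matrix of the Clebsch–Gordan map is then exactly
`Z* Qγ Z` (`choiMatrix_cgMap`). By Frobenius reciprocity (`mem_Hom_conjRep_iff`), `Y = Qγ^{1/2} Z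
(Qα^{-1/2} ⊗ 1)` intertwines `ᾱ ⊗ β` with `γ̄`, and the Choi matrix equals `(Qα^{1/2} ⊗ 1) Y*Y
(Qα^{1/2} ⊗ 1)`.

Irreducibility gives `Y Y* = r`, and multiplicity-freeness makes `Y*` span `Hom(γ̄, ᾱ ⊗ β)`, so
`Y*Y` is `r` times the projection onto the component (`componentProj_eq`). To find `r`, rewrite `Y
Y* = r` as `Z (Qα⁻¹ ⊗ 1) Z* = r Qγ⁻¹` and take traces: since `V` is isometric the left side has
trace `Tr Qα⁻¹` (`trace_rearrange`), and the normalization `Tr Q = Tr Q⁻¹` yields `r = d_α / d_γ`.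

Existence of `V` is the same correspondence read backwards, from a nonzero element of `Hom(γ̄, ᾱ ⊗
β)`. -/

namespace CQG

/-! ### Intertwiners, Schur's lemma and multiplicity one -/

section Intertwiners

variable {A : Type u} [CStarAlgebra A]
variable {l m n : Type*} [Fintype l] [DecidableEq l] [Fintype m] [DecidableEq m]
  [Fintype n] [DecidableEq n]

theorem scalarMat_mul (S : Matrix l m ℂ) (T : Matrix m n ℂ) :
    scalarMat A (S * T) = scalarMat A S * scalarMat A T :=
  Matrix.map_mul

theorem scalarMat_one : scalarMat A (1 : Matrix n n ℂ) = 1 :=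
  Matrix.map_one _ (map_zero _) (map_one _)

theorem scalarMat_smul (c : ℂ) (T : Matrix m n ℂ) :
    scalarMat A (c • T) = c • scalarMat A T := by
  ext i j
  simp [scalarMat, Algebra.smul_def]

theorem scalarMat_conjTranspose (T : Matrix m n ℂ) :
    (scalarMat A T).conjTranspose = scalarMat A T.conjTranspose := by
  ext i j
  simpa [scalarMat] using (algebraMap_star_comm (T j i)).symm

theorem mem_Hom_iff {u : Matrix n n A} {v : Matrix m m A} {T : Matrix m n ℂ} :
    T ∈ Hom u v ↔ ∀ i j, ∑ k, T k j • v i k = ∑ k, T i k • u k j := by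
  simp only [Hom, Set.mem_ofPred_eq, ← Matrix.ext_iff, Matrix.mul_apply, scalarMat,
    Matrix.map_apply, Algebra.smul_def, Algebra.commutes]

theorem Hom.mul {u : Matrix l l A} {v : Matrix m m A} {w : Matrix n n A}
    {T : Matrix n m ℂ} {S : Matrix m l ℂ} (hT : T ∈ Hom v w) (hS : S ∈ Hom u v) :
    T * S ∈ Hom u w := by
  simp only [Hom, Set.mem_ofPred_eq] at *
  rw [scalarMat_mul, ← Matrix.mul_assoc, hT, Matrix.mul_assoc, hS, Matrix.mul_assoc]

theorem Hom.smul {u : Matrix n n A} {v : Matrix m m A} {T : Matrix m n ℂ} (c : ℂ)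
    (hT : T ∈ Hom u v) : c • T ∈ Hom u v := by
  simp only [Hom, Set.mem_ofPred_eq] at *
  rw [scalarMat_smul, Matrix.mul_smul, hT, Matrix.smul_mul]

theorem Hom.of_inverse {u : Matrix n n A} {v : Matrix m m A} {T : Matrix m n ℂ}
    {S : Matrix n m ℂ} (hT : T ∈ Hom u v) (h₁ : T * S = 1) (h₂ : S * T = 1) :
    S ∈ Hom v u := by
  simp only [Hom, Set.mem_ofPred_eq] at *
  calc u * scalarMat A S = scalarMat A (S * T) * u * scalarMat A S := by
        rw [h₂, scalarMat_one, Matrix.one_mul]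
    _ = scalarMat A S * (scalarMat A T * u) * scalarMat A S := by
        rw [scalarMat_mul, Matrix.mul_assoc (scalarMat A S)]
    _ = scalarMat A S * v * scalarMat A (T * S) := by
        rw [← hT, scalarMat_mul]; simp only [Matrix.mul_assoc]
    _ = scalarMat A S * v := by rw [h₁, scalarMat_one, Matrix.mul_one]

theorem Hom.conjTranspose {u : Matrix n n A} {v : Matrix m m A} {T : Matrix m n ℂ}
    (hu : u ∈ unitary (Matrix n n A)) (hv : v ∈ unitary (Matrix m m A)) (hT : T ∈ Hom u v) :
    T.conjTranspose ∈ Hom v u := by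
  have huu : u * u.conjTranspose = 1 := (Unitary.mem_iff.1 hu).2
  have hvv : v.conjTranspose * v = 1 := (Unitary.mem_iff.1 hv).1
  simp only [Hom, Set.mem_ofPred_eq] at *
  have h : v.conjTranspose * scalarMat A T = scalarMat A T * u.conjTranspose := by
    calc v.conjTranspose * scalarMat A T
        = v.conjTranspose * (scalarMat A T * (u * u.conjTranspose)) := by
          rw [huu, Matrix.mul_one]
      _ = v.conjTranspose * (v * scalarMat A T) * u.conjTranspose := by
          rw [hT]; simp only [Matrix.mul_assoc]
      _ = scalarMat A T * u.conjTranspose := by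
          rw [← Matrix.mul_assoc v.conjTranspose, hvv, Matrix.one_mul]
  have h' := congrArg Matrix.conjTranspose h
  simp only [Matrix.conjTranspose_mul, Matrix.conjTranspose_conjTranspose,
    scalarMat_conjTranspose] at h'
  exact h'.symm

/-- **Schur's lemma**: a nonzero intertwiner between unitary matrices with trivial commutants is a
multiple of a unitary. -/
theorem Hom.schur {u : Matrix n n A} {v : Matrix m m A} {T : Matrix m n ℂ}
    (hu : u ∈ unitary (Matrix n n A)) (hv : v ∈ unitary (Matrix m m A))
    (hu' : ∀ S ∈ Hom u u, ∃ c : ℂ, S = c • (1 : Matrix n n ℂ))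
    (hv' : ∀ S ∈ Hom v v, ∃ c : ℂ, S = c • (1 : Matrix m m ℂ))
    (hT : T ∈ Hom u v) (hT0 : T ≠ 0) :
    ∃ c : ℂ, c ≠ 0 ∧ T.conjTranspose * T = c • (1 : Matrix n n ℂ) ∧
      T * T.conjTranspose = c • (1 : Matrix m m ℂ) := by
  obtain ⟨c, hc⟩ := hu' _ (Hom.mul (Hom.conjTranspose hu hv hT) hT)
  obtain ⟨d, hd⟩ := hv' _ (Hom.mul hT (Hom.conjTranspose hu hv hT))
  -- The two scalars agree because both describe `T T* T`.
  have hcd : c • T = d • T := by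
    calc c • T = T * (T.conjTranspose * T) := by rw [hc]; simp
      _ = d • T := by rw [← Matrix.mul_assoc, hd]; simp
  have hcd' : c = d := smul_left_injective ℂ hT0 hcd
  refine ⟨c, ?_, hc, hcd' ▸ hd⟩
  rintro rfl
  rw [zero_smul] at hc
  exact hT0 (Matrix.conjTranspose_mul_self_eq_zero.1 hc)

/-- Two unitary matrices with trivial commutants that receive nonzero intertwiners from a third one
are equivalent. -/
theorem Equivalent.of_ne_zero {g : Matrix l l A} {u : Matrix n n A} {v : Matrix m m A}
    (hg : g ∈ unitary (Matrix l l A))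
    (hu : u ∈ unitary (Matrix n n A)) (hv : v ∈ unitary (Matrix m m A))
    (hg' : ∀ S ∈ Hom g g, ∃ c : ℂ, S = c • (1 : Matrix l l ℂ))
    (hu' : ∀ S ∈ Hom u u, ∃ c : ℂ, S = c • (1 : Matrix n n ℂ))
    (hv' : ∀ S ∈ Hom v v, ∃ c : ℂ, S = c • (1 : Matrix m m ℂ))
    {S : Matrix n l ℂ} {T : Matrix m l ℂ} (hS : S ∈ Hom g u) (hT : T ∈ Hom g v)
    (hS0 : S ≠ 0) (hT0 : T ≠ 0) : Equivalent u v := by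
  obtain ⟨c, hc, hc₁, hc₂⟩ := Hom.schur hg hu hg' hu' hS hS0
  obtain ⟨d, hd, hd₁, hd₂⟩ := Hom.schur hg hv hg' hv' hT hT0
  -- `S` and `T` are unitary up to scalars, so the inverse of `T S*` is its adjoint divided by `c
  -- d`.
  refine ⟨T * S.conjTranspose, Hom.mul hT (Hom.conjTranspose hg hu hS),
    (c⁻¹ * d⁻¹) • (S * T.conjTranspose), ?_, ?_⟩
  · calc T * S.conjTranspose * ((c⁻¹ * d⁻¹) • (S * T.conjTranspose))
        = (c⁻¹ * d⁻¹) • (T * (S.conjTranspose * S) * T.conjTranspose) := by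
          rw [Matrix.mul_smul]; simp only [Matrix.mul_assoc]
      _ = 1 := by
          rw [hc₁, Matrix.mul_smul, Matrix.mul_one, Matrix.smul_mul, hd₂, smul_smul, smul_smul]
          have : c⁻¹ * d⁻¹ * (c * d) = 1 := by field_simp
          rw [← mul_assoc] at this
          rw [this, one_smul]
  · calc (c⁻¹ * d⁻¹) • (S * T.conjTranspose) * (T * S.conjTranspose)
        = (c⁻¹ * d⁻¹) • (S * (T.conjTranspose * T) * S.conjTranspose) := by
          rw [Matrix.smul_mul]; simp only [Matrix.mul_assoc]
      _ = 1 := by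
          rw [hd₁, Matrix.mul_smul, Matrix.mul_one, Matrix.smul_mul, hc₂, smul_smul, smul_smul]
          have : c⁻¹ * d⁻¹ * d * c = 1 := by field_simp
          rw [this, one_smul]

theorem Hom.eq_smul {u : Matrix n n A} {v : Matrix m m A} {S T : Matrix m n ℂ}
    (hu : u ∈ unitary (Matrix n n A)) (hv : v ∈ unitary (Matrix m m A))
    (hu' : ∀ S ∈ Hom u u, ∃ c : ℂ, S = c • (1 : Matrix n n ℂ))
    (hv' : ∀ S ∈ Hom v v, ∃ c : ℂ, S = c • (1 : Matrix m m ℂ))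
    (hS : S ∈ Hom u v) (hT : T ∈ Hom u v) (hS0 : S ≠ 0) : ∃ c : ℂ, T = c • S := by
  obtain ⟨c, hc, -, hc₂⟩ := Hom.schur hu hv hu' hv' hS hS0
  obtain ⟨d, hd⟩ := hu' _ (Hom.mul (Hom.conjTranspose hu hv hS) hT)
  refine ⟨c⁻¹ * d, ?_⟩
  calc T = c⁻¹ • ((c • (1 : Matrix m m ℂ)) * T) := by
        rw [Matrix.smul_mul, Matrix.one_mul, smul_smul, inv_mul_cancel₀ hc, one_smul]
    _ = (c⁻¹ * d) • S := by
        rw [← hc₂, Matrix.mul_assoc, hd, Matrix.mul_smul, Matrix.mul_one, smul_smul]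

theorem Hom.submatrix_blockDiagonal' {ι : Type*} [Fintype ι] [DecidableEq ι] {d : ι → Type*}
    [∀ j, Fintype (d j)] [∀ j, DecidableEq (d j)] {g : Matrix n n A}
    {u : ∀ j, Matrix (d j) (d j) A} {T : Matrix (Σ j, d j) n ℂ}
    (hT : T ∈ Hom g (Matrix.blockDiagonal' u)) (j : ι) :
    T.submatrix (Sigma.mk j) id ∈ Hom g (u j) := by
  rw [mem_Hom_iff] at hT ⊢
  intro i k
  have h := hT ⟨j, i⟩ k
  rw [Fintype.sum_sigma, Finset.sum_eq_single j] at h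
  · simpa [Matrix.blockDiagonal'_apply_eq] using h
  · intro j' _ hj'
    exact Finset.sum_eq_zero fun x _ => by
      rw [Matrix.blockDiagonal'_apply_ne _ _ _ hj'.symm, smul_zero]
  · simp

/-- Some block `j` of `S` is nonzero. A nonzero block `k ≠ j` of any intertwiner from `g` would make
the summands `j` and `k` equivalent, so everything lives in block `j`, where Schur's lemma leaves
one scalar. -/
theorem CompactQuantumGroup.IsMultiplicityFree.eq_smul {G : CompactQuantumGroup A}
    {v : Matrix m m A} (hmf : G.IsMultiplicityFree v) {g : Matrix n n A}
    (hg : g ∈ unitary (Matrix n n A))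
    (hg' : ∀ S ∈ Hom g g, ∃ c : ℂ, S = c • (1 : Matrix n n ℂ))
    {S T : Matrix m n ℂ} (hS : S ∈ Hom g v) (hT : T ∈ Hom g v) (hS0 : S ≠ 0) :
    ∃ c : ℂ, T = c • S := by
  obtain ⟨N, d, u, hirr, hineq, R, hR, R', h₁, h₂⟩ := hmf
  have hR' := Hom.of_inverse hR h₁ h₂
  have hS' := Hom.mul hR' hS
  have hT' := Hom.mul hR' hT
  have hback : ∀ X : Matrix m n ℂ, R * (R' * X) = X := fun X => by
    rw [← Matrix.mul_assoc, h₁, Matrix.one_mul]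
  obtain ⟨j, hj⟩ : ∃ j, (R' * S).submatrix (Sigma.mk j) id ≠ 0 := by
    by_contra! h
    apply hS0
    have : R' * S = 0 := by
      ext ⟨j, i⟩ k
      exact congrFun (congrFun (h j) i) k
    rw [← hback S, this, Matrix.mul_zero]
  obtain ⟨c, hc⟩ := Hom.eq_smul hg (hirr j).1.2 hg' (hirr j).2.2
    (Hom.submatrix_blockDiagonal' hS' j) (Hom.submatrix_blockDiagonal' hT' j) hj
  refine ⟨c, ?_⟩
  have key : R' * T = c • (R' * S) := by
    have hk : ∀ k, k ≠ j → ∀ X ∈ Hom g (Matrix.blockDiagonal' u),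
        X.submatrix (Sigma.mk k) id = 0 := by
      intro k hkj X hX
      by_contra hne
      exact hineq j k hkj.symm (Equivalent.of_ne_zero hg (hirr j).1.2 (hirr k).1.2 hg'
        (hirr j).2.2 (hirr k).2.2 (Hom.submatrix_blockDiagonal' hS' j)
        (Hom.submatrix_blockDiagonal' hX k) hj hne)
    ext ⟨k, i⟩ x
    by_cases hkj : k = j
    · subst hkj
      exact congrFun (congrFun hc i) x
    · have e₁ := congrFun (congrFun (hk k hkj _ hT') i) x
      have e₂ := congrFun (congrFun (hk k hkj _ hS') i) x
      simp only [Matrix.submatrix_apply, id, Matrix.zero_apply] at e₁ e₂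
      rw [Matrix.smul_apply, e₁, e₂, smul_zero]
  rw [← hback T, key, Matrix.mul_smul, hback]

theorem CompactQuantumGroup.IsSubrep.exists_ne_zero {G : CompactQuantumGroup A}
    {u : Matrix n n A} {v : Matrix m m A} (h : G.IsSubrep u v) [Nonempty n] :
    ∃ T ∈ Hom u v, T ≠ 0 := by
  obtain ⟨k, w, -, R, hR, R', -, h₂⟩ := h
  refine ⟨R.submatrix id Sum.inl, ?_, ?_⟩
  · rw [mem_Hom_iff] at hR ⊢
    intro i j
    simpa [Fintype.sum_sum_type] using hR i (Sum.inl j)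
  -- A vanishing restriction would kill a column of `R`, contradicting the diagonal entry 1 of `R'
  -- R`.
  · intro h0
    obtain ⟨x⟩ := ‹Nonempty n›
    have h := congrFun (congrFun h₂ (Sum.inl x)) (Sum.inl x)
    rw [Matrix.mul_apply, Matrix.one_apply_eq, Finset.sum_eq_zero] at h
    · exact zero_ne_one h
    · intro y _
      have : R y (Sum.inl x) = 0 := congrFun (congrFun h0 y) x
      rw [this, mul_zero]

end Intertwiners

/-! ### Conjugate representations and Frobenius reciprocity -/

section Conjugates

variable {A : Type u} [CStarAlgebra A]
variable {l m n : Type*} [Fintype l] [DecidableEq l] [Fintype m] [DecidableEq m]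
  [Fintype n] [DecidableEq n]

theorem sqrt_mul_sqrt {Q : Matrix n n ℂ} (hQ : Q.PosDef) : CFC.sqrt Q * CFC.sqrt Q = Q :=
  CFC.sqrt_mul_sqrt_self Q (Matrix.nonneg_iff_posSemidef.2 hQ.posSemidef)

theorem conjTranspose_sqrt (Q : Matrix n n ℂ) : (CFC.sqrt Q).conjTranspose = CFC.sqrt Q :=
  (Matrix.nonneg_iff_posSemidef.1 (CFC.sqrt_nonneg Q)).isHermitian

theorem isUnit_det_sqrt {Q : Matrix n n ℂ} (hQ : Q.PosDef) : IsUnit (CFC.sqrt Q).det := by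
  have h : IsUnit (CFC.sqrt Q * CFC.sqrt Q).det := by
    rw [sqrt_mul_sqrt hQ]
    exact (Matrix.isUnit_iff_isUnit_det Q).1 hQ.isUnit
  rw [Matrix.det_mul] at h
  exact isUnit_of_mul_isUnit_left h

theorem sqrt_mem_Hom (u : Matrix n n A) {Q : Matrix n n ℂ} (hQ : Q.PosDef) :
    CFC.sqrt Q ∈ Hom (contragredient u) (conjRep u Q) := by
  simp only [Hom, Set.mem_ofPred_eq, conjRep]
  rw [Matrix.mul_assoc, ← scalarMat_mul, Matrix.nonsing_inv_mul _ (isUnit_det_sqrt hQ),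
    scalarMat_one, Matrix.mul_one]

theorem inv_sqrt_mem_Hom (u : Matrix n n A) {Q : Matrix n n ℂ} (hQ : Q.PosDef) :
    (CFC.sqrt Q)⁻¹ ∈ Hom (conjRep u Q) (contragredient u) :=
  Hom.of_inverse (sqrt_mem_Hom u hQ) (Matrix.mul_nonsing_inv _ (isUnit_det_sqrt hQ))
    (Matrix.nonsing_inv_mul _ (isUnit_det_sqrt hQ))

theorem one_mem_Hom (u : Matrix n n A) : (1 : Matrix n n ℂ) ∈ Hom u u := by
  simp [Hom, scalarMat_one]

/-- Entrywise complex conjugation carries the commutant of `u^c` to that of `u`. -/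
theorem Hom.eq_smul_one_of_contragredient {u : Matrix n n A}
    (hu : ∀ S ∈ Hom u u, ∃ c : ℂ, S = c • (1 : Matrix n n ℂ)) {T : Matrix n n ℂ}
    (hT : T ∈ Hom (contragredient u) (contragredient u)) :
    ∃ c : ℂ, T = c • (1 : Matrix n n ℂ) := by
  have h : T.map star ∈ Hom u u := by
    rw [mem_Hom_iff] at hT ⊢
    intro i j
    simpa [contragredient] using congrArg star (hT i j)
  obtain ⟨c, hc⟩ := hu _ h
  refine ⟨star c, ?_⟩
  ext i j
  have := congrArg star (congrFun (congrFun hc i) j)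
  simpa [Matrix.one_apply, apply_ite] using this

theorem Hom.eq_smul_one_of_conjRep {u : Matrix n n A}
    (hu : ∀ S ∈ Hom u u, ∃ c : ℂ, S = c • (1 : Matrix n n ℂ)) {Q : Matrix n n ℂ}
    (hQ : Q.PosDef) {T : Matrix n n ℂ} (hT : T ∈ Hom (conjRep u Q) (conjRep u Q)) :
    ∃ c : ℂ, T = c • (1 : Matrix n n ℂ) := by
  have hdet := isUnit_det_sqrt hQ
  obtain ⟨c, hc⟩ := Hom.eq_smul_one_of_contragredient hu
    (Hom.mul (inv_sqrt_mem_Hom u hQ) (Hom.mul hT (sqrt_mem_Hom u hQ)))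
  refine ⟨c, ?_⟩
  calc T = CFC.sqrt Q * ((CFC.sqrt Q)⁻¹ * (T * CFC.sqrt Q)) * (CFC.sqrt Q)⁻¹ := by
        rw [Matrix.mul_nonsing_inv_cancel_left _ _ hdet, Matrix.mul_nonsing_inv_cancel_right _ _ hdet]
    _ = c • 1 := by
        rw [hc, Matrix.mul_smul, Matrix.mul_one, Matrix.smul_mul, Matrix.mul_nonsing_inv _ hdet]

theorem unitary_sum_right {u : Matrix n n A} (hu : u ∈ unitary (Matrix n n A)) (i j : n) :
    ∑ k, u i k * star (u j k) = if i = j then 1 else 0 := by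
  have h := congrFun (congrFun (Unitary.mem_iff.1 hu).2 i) j
  simpa [Matrix.mul_apply, Matrix.one_apply, Matrix.star_apply] using h

theorem unitary_sum_left {u : Matrix n n A} (hu : u ∈ unitary (Matrix n n A)) (i j : n) :
    ∑ k, star (u k i) * u k j = if i = j then 1 else 0 := by
  have h := congrFun (congrFun (Unitary.mem_iff.1 hu).1 i) j
  simpa [Matrix.mul_apply, Matrix.one_apply, Matrix.star_apply] using h

theorem tensorRep_mem_unitary {u : Matrix n n A} {v : Matrix m m A}
    (hu : u ∈ unitary (Matrix n n A)) (hv : v ∈ unitary (Matrix m m A)) :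
    tensorRep u v ∈ unitary (Matrix (n × m) (n × m) A) := by
  refine Unitary.mem_iff.2 ⟨?_, ?_⟩
  · ext ⟨i, j⟩ ⟨i', j'⟩
    -- Entries of `u` and `v` need not commute, so the adjacent `u` factors in the middle are
    -- collapsed first; in the other product the `v` factors are the inner ones.
    calc ∑ x : n × m, star (u x.1 i * v x.2 j) * (u x.1 i' * v x.2 j')
        = ∑ y, star (v y j) * (∑ x, star (u x i) * u x i') * v y j' := by
          rw [Fintype.sum_prod_type_right]
          simp only [star_mul, Finset.mul_sum, Finset.sum_mul, mul_assoc]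
      _ = (1 : Matrix (n × m) (n × m) A) (i, j) (i', j') := by
          rw [unitary_sum_left hu]
          by_cases h : i = i'
          · simp [h, unitary_sum_left hv, Matrix.one_apply]
          · simp [h]
  · ext ⟨i, j⟩ ⟨i', j'⟩
    calc ∑ x : n × m, u i x.1 * v j x.2 * star (u i' x.1 * v j' x.2)
        = ∑ x, u i x * (∑ y, v j y * star (v j' y)) * star (u i' x) := by
          rw [Fintype.sum_prod_type]
          simp only [star_mul, Finset.mul_sum, Finset.sum_mul, mul_assoc]
      _ = (1 : Matrix (n × m) (n × m) A) (i, j) (i', j') := by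
          rw [unitary_sum_right hv]
          by_cases h : j = j'
          · simp [h, unitary_sum_right hu, Matrix.one_apply]
          · simp [h]

theorem Hom.kronecker_one {u : Matrix n n A} {v : Matrix m m A} {T : Matrix m n ℂ}
    (hT : T ∈ Hom u v) (w : Matrix l l A) :
    T ⊗ₖ (1 : Matrix l l ℂ) ∈ Hom (tensorRep u w) (tensorRep v w) := by
  rw [mem_Hom_iff] at hT ⊢
  rintro ⟨i, k⟩ ⟨j, k'⟩
  simpa [Fintype.sum_prod_type, tensorRep, Matrix.one_apply, ite_smul, Finset.sum_mul]
    using congrArg (· * w k k') (hT i j)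

/-- **Frobenius reciprocity**: `Hom(v ⊗ w, u)` and `Hom(u^c ⊗ v, w^c)` consist of the same arrays of
numbers. -/
theorem mem_Hom_contragredient_iff {u : Matrix n n A} {v : Matrix m m A} {w : Matrix l l A}
    (hu : u ∈ unitary (Matrix n n A)) (hw : w ∈ unitary (Matrix l l A))
    (X : Matrix n (m × l) ℂ) :
    (Matrix.of fun c (p : n × m) => X p.1 (p.2, c)) ∈
      Hom (tensorRep (contragredient u) v) (contragredient w) ↔
    X ∈ Hom (tensorRep v w) u := by
  simp only [mem_Hom_iff, Prod.forall, Fintype.sum_prod_type, Matrix.of_apply, tensorRep,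
    Matrix.kroneckerMap_apply, contragredient, Matrix.map_apply]
  constructor
  · intro h a b c
    -- Multiplying by `u` on the left and `w` on the right and summing lets unitarity move `u^c` and
    -- `w^c` across the equation; the converse multiplies by their adjoints.
    have key : ∑ d, ∑ a', u a a' * (∑ k, X a' (b, k) • star (w d k)) * w d c =
        ∑ d, ∑ a', u a a' * (∑ x, ∑ y, X x (y, d) • (star (u x a') * v y b)) * w d c := by
      simp only [h]
    have hl : ∑ d, ∑ a', u a a' * (∑ k, X a' (b, k) • star (w d k)) * w d c =
        ∑ a', ∑ k, X a' (b, k) • (u a a' * ∑ d, star (w d k) * w d c) := by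
      rw [Finset.sum_comm]
      refine Finset.sum_congr rfl fun a' _ => ?_
      simp only [Finset.mul_sum, Finset.sum_mul, Finset.smul_sum]
      rw [Finset.sum_comm]
      simp only [mul_smul_comm, smul_mul_assoc, mul_assoc]
    have hr : ∑ d, ∑ a', u a a' * (∑ x, ∑ y, X x (y, d) • (star (u x a') * v y b)) * w d c =
        ∑ y, ∑ d, ∑ x, X x (y, d) • ((∑ a', u a a' * star (u x a')) * v y b * w d c) := by
      rw [Finset.sum_comm (s := (Finset.univ : Finset m))]
      refine Finset.sum_congr rfl fun d _ => ?_
      simp only [Finset.mul_sum, Finset.sum_mul, Finset.smul_sum]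
      simp only [mul_smul_comm, smul_mul_assoc, mul_assoc]
      rw [Finset.sum_comm]
      rw [Finset.sum_comm (s := (Finset.univ : Finset m))]
      refine Finset.sum_congr rfl fun x _ => ?_
      rw [Finset.sum_comm]
    rw [hl, hr] at key
    simpa [unitary_sum_left hw, unitary_sum_right hu] using key
  · intro h d a b
    have key : ∑ c, ∑ a', star (u a' a) * (∑ k, X k (b, c) • u a' k) * star (w d c) =
        ∑ c, ∑ a', star (u a' a) * (∑ x, ∑ y, X a' (x, y) • (v x b * w y c)) * star (w d c) := by
      simp only [h]
    have hl : ∑ c, ∑ a', star (u a' a) * (∑ k, X k (b, c) • u a' k) * star (w d c) =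
        ∑ c, ∑ k, X k (b, c) • ((∑ a', star (u a' a) * u a' k) * star (w d c)) := by
      refine Finset.sum_congr rfl fun c _ => ?_
      simp only [Finset.mul_sum, Finset.sum_mul, Finset.smul_sum]
      rw [Finset.sum_comm]
      simp only [mul_smul_comm, smul_mul_assoc, mul_assoc]
    have hr : ∑ c, ∑ a', star (u a' a) * (∑ x, ∑ y, X a' (x, y) • (v x b * w y c)) *
        star (w d c) =
        ∑ a', ∑ x, ∑ y, X a' (x, y) • (star (u a' a) * v x b * ∑ c, w y c * star (w d c)) := by
      rw [Finset.sum_comm]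
      refine Finset.sum_congr rfl fun a' _ => ?_
      simp only [Finset.mul_sum, Finset.sum_mul, Finset.smul_sum]
      simp only [mul_smul_comm, smul_mul_assoc, mul_assoc]
      rw [Finset.sum_comm]
      refine Finset.sum_congr rfl fun x _ => ?_
      rw [Finset.sum_comm]
    rw [hl, hr] at key
    simpa [unitary_sum_left hu, unitary_sum_right hw] using key

end Conjugates

/-! ### Choi matrix, trace identity and component projection -/

section ClebschGordan

variable {A : Type u} [CStarAlgebra A]
variable {l m n : Type*} [Fintype l] [DecidableEq l] [Fintype m] [DecidableEq m]
  [Fintype n] [DecidableEq n]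

/-- The array `X` with its indices rearranged as in Frobenius reciprocity. -/
def rearrange (X : Matrix n (m × l) ℂ) : Matrix l (n × m) ℂ :=
  Matrix.of fun c p => X p.1 (p.2, c)

theorem rearrange_ne_zero {X : Matrix n (m × l) ℂ} (hX : X ≠ 0) : rearrange X ≠ 0 := by
  intro h
  apply hX
  ext a ⟨b, c⟩
  exact congrFun (congrFun h c) (a, b)

/-- The transpose in `quantumTrace` is what makes `Q` itself, not its transpose, appear in the
middle. -/
theorem choiMatrix_cgMap (Q : Matrix n n ℂ) (V : Matrix (m × n) l ℂ) :
    choiMatrix (cgMap Q V) =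
      (rearrange V.conjTranspose).conjTranspose * Q * rearrange V.conjTranspose := by
  ext ⟨i, b⟩ ⟨j, b'⟩
  have h : choiMatrix (cgMap Q V) (i, b) (j, b') = cgMap Q V (Matrix.single i j 1) b b' := by
    simp only [choiMatrix, Matrix.sum_apply, Matrix.kroneckerMap_apply, Matrix.single_apply]
    rw [Finset.sum_eq_single i, Finset.sum_eq_single j] <;> simp +contextual
  rw [h]
  have hV : ∀ p q, (V * Matrix.single i j (1 : ℂ) * V.conjTranspose) p q =
      V p i * star (V q j) := by
    intro p q
    rw [Matrix.mul_apply, Finset.sum_eq_single j]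
    · simp
    · intro x _ hx
      rw [Matrix.mul_single_apply_of_ne _ _ _ _ _ hx, zero_mul]
    · simp
  have hR : ((rearrange V.conjTranspose).conjTranspose * Q * rearrange V.conjTranspose)
      (i, b) (j, b') = ∑ x, ∑ y, V (b, y) i * Q y x * star (V (b', x) j) := by
    rw [Matrix.mul_apply]
    refine Finset.sum_congr rfl fun x _ => ?_
    rw [Matrix.mul_apply, Finset.sum_mul]
    simp [rearrange]
  have hL : cgMap Q V (Matrix.single i j 1) b b' =
      ∑ x, ∑ y, Q y x * (V * Matrix.single i j (1 : ℂ) * V.conjTranspose) (b, y) (b', x) := by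
    simp only [cgMap, partialQuantumTrace, quantumTrace, LinearMap.coe_mk, AddHom.coe_mk,
      Matrix.of_apply, Matrix.trace, Matrix.diag_apply]
    refine Finset.sum_congr rfl fun x _ => ?_
    rw [Matrix.mul_apply]
    rfl
  rw [hR, hL]
  refine Finset.sum_congr rfl fun x _ => Finset.sum_congr rfl fun y _ => ?_
  rw [hV]
  ring

/-- Summing over the indices of `m` and `n` reassembles the entries of `V* V`, which is where
isometry enters. -/
theorem trace_rearrange (P : Matrix l l ℂ) {V : Matrix (m × n) l ℂ}
    (hV : V.conjTranspose * V = 1) :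
    (rearrange V.conjTranspose * (P ⊗ₖ (1 : Matrix m m ℂ)) *
      (rearrange V.conjTranspose).conjTranspose).trace = P.trace := by
  have h : P.trace = ∑ a', ∑ a, P a a' * (V.conjTranspose * V) a a' := by
    simp [hV, Matrix.trace, Matrix.one_apply]
  rw [h, Matrix.trace]
  simp only [Matrix.diag_apply, Matrix.mul_apply, Matrix.conjTranspose_apply, rearrange,
    Matrix.of_apply, Fintype.sum_prod_type, Matrix.kroneckerMap_apply, Matrix.one_apply,
    star_star, mul_ite, mul_one, mul_zero, Finset.sum_ite_eq', Finset.mem_univ, if_true,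
    Finset.mul_sum, Finset.sum_mul]
  rw [Finset.sum_comm]
  refine Finset.sum_congr rfl fun a' _ => ?_
  simp only [Finset.sum_comm (s := (Finset.univ : Finset n))]
  rw [Finset.sum_comm]
  refine Finset.sum_congr rfl fun a _ => Finset.sum_congr rfl fun b _ =>
    Finset.sum_congr rfl fun c _ => ?_
  ring

/-- The component is the range of `W`, and `W* (1 - r⁻¹ W W*) = 0` makes the residual orthogonal to
it. -/
theorem componentProj_eq {g : Matrix n n A} {v : Matrix m m A} {W : Matrix m n ℂ}
    (hW : W ∈ Hom g v) (hspan : ∀ T ∈ Hom g v, ∃ c : ℂ, T = c • W) {r : ℂ} (hr : r ≠ 0)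
    (hWW : W.conjTranspose * W = r • (1 : Matrix n n ℂ)) :
    componentProj g v = r⁻¹ • (W * W.conjTranspose) := by
  rw [componentProj, LinearEquiv.symm_apply_eq]
  ext1 x
  change (component g v).starProjection x = _
  apply Submodule.eq_starProjection_of_mem_orthogonal
  · refine Submodule.subset_span ⟨W, hW, (r⁻¹ • W.conjTranspose).mulVec x.ofLp, ?_⟩
    rw [Matrix.toLpLin_apply, Matrix.mulVec_mulVec, Matrix.mul_smul]
  · rw [component, Submodule.mem_orthogonal]
    intro y hy
    induction hy using Submodule.span_induction with
    | mem y hy =>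
      obtain ⟨T, hT, z, rfl⟩ := hy
      obtain ⟨c, rfl⟩ := hspan T hT
      have hz : W.conjTranspose.mulVec
          (x.ofLp - (r⁻¹ • (W * W.conjTranspose)).mulVec x.ofLp) = 0 := by
        rw [Matrix.mulVec_sub, Matrix.mulVec_mulVec, Matrix.mul_smul, ← Matrix.mul_assoc, hWW,
          Matrix.smul_mul, Matrix.one_mul, smul_smul, inv_mul_cancel₀ hr, one_smul, sub_self]
      rw [EuclideanSpace.inner_eq_star_dotProduct]
      simp only [Matrix.toLpLin_apply, WithLp.ofLp_sub, Matrix.star_mulVec,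
        Matrix.conjTranspose_smul]
      rw [dotProduct_comm, ← Matrix.dotProduct_mulVec, Matrix.smul_mulVec, hz, smul_zero,
        dotProduct_zero]
    | zero => simp
    | add y z _ _ hy hz => rw [inner_add_left, hy, hz, add_zero]
    | smul c y _ hy => rw [inner_smul_left, hy, mul_zero]

theorem IsQMatrix.trace_inv {u : Matrix n n A} {Q : Matrix n n ℂ} (hQ : IsQMatrix u Q) :
    Q⁻¹.trace = Q.trace := by
  simpa using (hQ.trace_eq 1 (one_mem_Hom _)).symm

theorem inv_sqrt_mul_inv_sqrt {Q : Matrix n n ℂ} (hQ : Q.PosDef) :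
    (CFC.sqrt Q)⁻¹ * (CFC.sqrt Q)⁻¹ = Q⁻¹ := by
  rw [← Matrix.mul_inv_rev, sqrt_mul_sqrt hQ]

theorem conjTranspose_inv_sqrt (Q : Matrix n n ℂ) :
    ((CFC.sqrt Q)⁻¹).conjTranspose = (CFC.sqrt Q)⁻¹ := by
  rw [Matrix.conjTranspose_nonsing_inv, conjTranspose_sqrt]

/-- Frobenius reciprocity for conjugate representations. -/
theorem mem_Hom_conjRep_iff {u : Matrix n n A} {v : Matrix m m A} {w : Matrix l l A}
    (hu : u ∈ unitary (Matrix n n A)) (hw : w ∈ unitary (Matrix l l A))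
    {P : Matrix n n ℂ} {Q : Matrix l l ℂ} (hP : P.PosDef) (hQ : Q.PosDef)
    (X : Matrix n (m × l) ℂ) :
    CFC.sqrt Q * rearrange X * ((CFC.sqrt P)⁻¹ ⊗ₖ (1 : Matrix m m ℂ)) ∈
      Hom (tensorRep (conjRep u P) v) (conjRep w Q) ↔ X ∈ Hom (tensorRep v w) u := by
  rw [← mem_Hom_contragredient_iff hu hw]
  change _ ↔ rearrange X ∈ _
  constructor
  · intro h
    have h' := Hom.mul (inv_sqrt_mem_Hom w hQ)
      (Hom.mul h (Hom.kronecker_one (sqrt_mem_Hom u hP) v))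
    rwa [Matrix.mul_assoc, Matrix.mul_assoc, ← Matrix.mul_kronecker_mul,
      Matrix.nonsing_inv_mul _ (isUnit_det_sqrt hP), Matrix.one_mul, Matrix.one_kronecker_one,
      Matrix.mul_one, Matrix.nonsing_inv_mul_cancel_left _ _ (isUnit_det_sqrt hQ)] at h'
  · intro h
    exact Hom.mul (Hom.mul (sqrt_mem_Hom w hQ) h)
      (Hom.kronecker_one (inv_sqrt_mem_Hom u hP) v)

theorem exists_isIsometricIntertwiner {u : Matrix n n A} {v : Matrix m m A}
    (hu : u ∈ unitary (Matrix n n A)) (hv : v ∈ unitary (Matrix m m A)) [Nonempty n]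
    (hu' : ∀ S ∈ Hom u u, ∃ c : ℂ, S = c • (1 : Matrix n n ℂ))
    {T : Matrix m n ℂ} (hT : T ∈ Hom u v) (hT0 : T ≠ 0) :
    ∃ V, IsIsometricIntertwiner u v V := by
  obtain ⟨c, hc⟩ := hu' _ (Hom.mul (Hom.conjTranspose hu hv hT) hT)
  -- `c` is a diagonal entry of `T* T`, so `T` can be rescaled by `1 / √c`.
  have hc0 : 0 ≤ c := by
    obtain ⟨i⟩ := ‹Nonempty n›
    have h := (Matrix.posSemidef_conjTranspose_mul_self T).diag_nonneg (i := i)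
    simpa [hc] using h
  have hcne : c ≠ 0 := by
    rintro rfl
    rw [zero_smul] at hc
    exact hT0 (Matrix.conjTranspose_mul_self_eq_zero.1 hc)
  obtain ⟨r, hr, rfl⟩ := RCLike.nonneg_iff_exists_ofReal.1 hc0
  have hr0 : (r : ℂ) ≠ 0 := hcne
  refine ⟨((√r : ℝ) : ℂ)⁻¹ • T, Hom.smul _ hT, ?_⟩
  rw [Matrix.conjTranspose_smul, Matrix.smul_mul, Matrix.mul_smul, hc, smul_smul, smul_smul]
  have h : star (((√r : ℝ) : ℂ)⁻¹) * (((√r : ℝ) : ℂ)⁻¹ * r) = 1 := by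
    have h₂ : ((√r : ℝ) : ℂ) * (√r : ℝ) = r := by
      rw [← Complex.ofReal_mul, Real.mul_self_sqrt hr]
    have h₁ : ((√r : ℝ) : ℂ) ≠ 0 := fun h => by
      rw [h, zero_mul] at h₂
      exact hr0 h₂.symm
    rw [star_inv₀, Complex.star_def, Complex.conj_ofReal]
    rw [← h₂]
    field_simp
  rw [mul_assoc]
  exact (congrArg (· • (1 : Matrix n n ℂ)) h).trans (one_smul _ _)

end ClebschGordan

end CQG

/-! ### The Choi matrix of a Clebsch–Gordan map -/

theorem mainTheorem2 {A : Type u} [CStarAlgebra A] (G : CQG.CompactQuantumGroup A)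
    {nα nβ nγ : ℕ}
    (uα : Matrix (Fin nα) (Fin nα) A) (uβ : Matrix (Fin nβ) (Fin nβ) A)
    (uγ : Matrix (Fin nγ) (Fin nγ) A)
    (hα : G.IsIrrep uα) (hβ : G.IsIrrep uβ) (hγ : G.IsIrrep uγ)
    (Qα : Matrix (Fin nα) (Fin nα) ℂ) (hQα : CQG.IsQMatrix uα Qα)
    (Qγ : Matrix (Fin nγ) (Fin nγ) ℂ) (hQγ : CQG.IsQMatrix uγ Qγ)
    (hmf : G.IsMultiplicityFree (CQG.tensorRep (CQG.conjRep uα Qα) uβ))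
    (hsub : G.IsSubrep (CQG.conjRep uγ Qγ) (CQG.tensorRep (CQG.conjRep uα Qα) uβ)) :
    (∃ V : Matrix (Fin nβ × Fin nγ) (Fin nα) ℂ,
      CQG.IsIsometricIntertwiner uα (CQG.tensorRep uβ uγ) V) ∧
    ∀ V : Matrix (Fin nβ × Fin nγ) (Fin nα) ℂ,
      CQG.IsIsometricIntertwiner uα (CQG.tensorRep uβ uγ) V →
      CQG.choiMatrix (CQG.cgMap Qγ V) =
        (CQG.quantumDim Qα / CQG.quantumDim Qγ) •
          ((CFC.sqrt Qα ⊗ₖ (1 : Matrix (Fin nβ) (Fin nβ) ℂ)) *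
            CQG.componentProj (CQG.conjRep uγ Qγ) (CQG.tensorRep (CQG.conjRep uα Qα) uβ) *
            (CFC.sqrt Qα ⊗ₖ (1 : Matrix (Fin nβ) (Fin nβ) ℂ))) := by
  have := hα.2.1
  have := hγ.2.1
  have hβγ := CQG.tensorRep_mem_unitary hβ.1.2 hγ.1.2
  have hαβ := CQG.tensorRep_mem_unitary hQα.unitary_conj hβ.1.2
  have hdα := CQG.isUnit_det_sqrt hQα.posDef
  have hdγ := CQG.isUnit_det_sqrt hQγ.posDef
  have hcancel : ((CFC.sqrt Qα)⁻¹ ⊗ₖ (1 : Matrix (Fin nβ) (Fin nβ) ℂ)) *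
      (CFC.sqrt Qα ⊗ₖ (1 : Matrix (Fin nβ) (Fin nβ) ℂ)) = 1 := by
    rw [← Matrix.mul_kronecker_mul, Matrix.nonsing_inv_mul _ hdα, Matrix.one_mul,
      Matrix.one_kronecker_one]
  have hcancel' := mul_eq_one_comm.1 hcancel
  constructor
  · obtain ⟨T, hT, hT0⟩ := hsub.exists_ne_zero
    -- `Z` is chosen to undo the twists by `Qα` and `Qγ`, so that the Frobenius partner of `X` is
    -- `T*`.
    obtain ⟨Z, hZ⟩ : ∃ Z, Z = (CFC.sqrt Qγ)⁻¹ * T.conjTranspose *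
        (CFC.sqrt Qα ⊗ₖ (1 : Matrix (Fin nβ) (Fin nβ) ℂ)) := ⟨_, rfl⟩
    obtain ⟨X, hX⟩ : ∃ X : Matrix (Fin nα) (Fin nβ × Fin nγ) ℂ, CQG.rearrange X = Z :=
      ⟨Matrix.of fun a p => Z p.2 (a, p.1), rfl⟩
    have hXT : CFC.sqrt Qγ * CQG.rearrange X *
        ((CFC.sqrt Qα)⁻¹ ⊗ₖ (1 : Matrix (Fin nβ) (Fin nβ) ℂ)) = T.conjTranspose := by
      rw [hX, hZ, Matrix.mul_assoc, Matrix.mul_assoc _ (CFC.sqrt Qα ⊗ₖ _), hcancel', Matrix.mul_one,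
        Matrix.mul_nonsing_inv_cancel_left _ _ hdγ]
    have hXmem := (CQG.mem_Hom_conjRep_iff (v := uβ) hα.1.2 hγ.1.2 hQα.posDef hQγ.posDef X).1
      (hXT ▸ CQG.Hom.conjTranspose hQγ.unitary_conj hαβ hT)
    refine CQG.exists_isIsometricIntertwiner hα.1.2 hβγ hα.2.2
      (CQG.Hom.conjTranspose hβγ hα.1.2 hXmem) fun h0 => hT0 ?_
    rw [Matrix.conjTranspose_eq_zero] at h0
    rw [← Matrix.conjTranspose_eq_zero, ← hXT, h0]
    have : CQG.rearrange (0 : Matrix (Fin nα) (Fin nβ × Fin nγ) ℂ) = 0 := rfl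
    rw [this, Matrix.mul_zero, Matrix.zero_mul]
  · rintro V ⟨hV, hVV⟩
    have hV0 : V.conjTranspose ≠ 0 := fun h0 => by
      rw [h0, Matrix.zero_mul] at hVV
      exact zero_ne_one hVV
    obtain ⟨Z, hZ⟩ : ∃ Z, Z = CQG.rearrange V.conjTranspose := ⟨_, rfl⟩
    obtain ⟨Y, hY⟩ : ∃ Y, Y = CFC.sqrt Qγ * Z *
        ((CFC.sqrt Qα)⁻¹ ⊗ₖ (1 : Matrix (Fin nβ) (Fin nβ) ℂ)) := ⟨_, rfl⟩
    have hYmem := (CQG.mem_Hom_conjRep_iff (v := uβ) hα.1.2 hγ.1.2 hQα.posDef hQγ.posDef _).2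
      (CQG.Hom.conjTranspose hα.1.2 hβγ hV)
    rw [← hZ, ← hY] at hYmem
    have hYZ : Y * (CFC.sqrt Qα ⊗ₖ (1 : Matrix (Fin nβ) (Fin nβ) ℂ)) = CFC.sqrt Qγ * Z := by
      rw [hY, Matrix.mul_assoc, hcancel, Matrix.mul_one]
    have hY0 : Y.conjTranspose ≠ 0 := fun h0 => by
      rw [Matrix.conjTranspose_eq_zero] at h0
      apply CQG.rearrange_ne_zero hV0
      rw [← hZ, ← Matrix.nonsing_inv_mul_cancel_left _ Z hdγ, ← hYZ, h0, Matrix.zero_mul,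
        Matrix.mul_zero]
    have hW := CQG.Hom.conjTranspose hαβ hQγ.unitary_conj hYmem
    have hirr : ∀ S ∈ CQG.Hom (CQG.conjRep uγ Qγ) (CQG.conjRep uγ Qγ), ∃ c : ℂ, S = c • 1 :=
      fun S hS => CQG.Hom.eq_smul_one_of_conjRep hγ.2.2 hQγ.posDef hS
    obtain ⟨r, hr⟩ := hirr _ (CQG.Hom.mul hYmem hW)
    have hr0 : r ≠ 0 := by
      rintro rfl
      rw [zero_smul, Matrix.self_mul_conjTranspose_eq_zero] at hr
      exact hY0 (by rw [hr, Matrix.conjTranspose_zero])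
    -- Applied with `W = Y*`, this gives the projection as `r⁻¹ Y* Y`.
    have hproj := CQG.componentProj_eq hW
      (fun T hT => hmf.eq_smul hQγ.unitary_conj hirr hW hT hY0) hr0
      (by rwa [Matrix.conjTranspose_conjTranspose])
    rw [Matrix.conjTranspose_conjTranspose] at hproj
    have hYY : Y * Y.conjTranspose =
        CFC.sqrt Qγ * (Z * (Qα⁻¹ ⊗ₖ (1 : Matrix (Fin nβ) (Fin nβ) ℂ)) * Z.conjTranspose) *
          CFC.sqrt Qγ := by
      rw [hY, Matrix.conjTranspose_mul, Matrix.conjTranspose_mul, CQG.conjTranspose_sqrt,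
        Matrix.conjTranspose_kronecker, CQG.conjTranspose_inv_sqrt, Matrix.conjTranspose_one,
        ← CQG.inv_sqrt_mul_inv_sqrt hQα.posDef]
      have h : ((CFC.sqrt Qα)⁻¹ * (CFC.sqrt Qα)⁻¹) ⊗ₖ (1 : Matrix (Fin nβ) (Fin nβ) ℂ) =
          ((CFC.sqrt Qα)⁻¹ ⊗ₖ (1 : Matrix (Fin nβ) (Fin nβ) ℂ)) *
            ((CFC.sqrt Qα)⁻¹ ⊗ₖ (1 : Matrix (Fin nβ) (Fin nβ) ℂ)) := by
        rw [← Matrix.mul_kronecker_mul, Matrix.one_mul]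
      rw [h]
      simp only [Matrix.mul_assoc]
    have hZZ : Z * (Qα⁻¹ ⊗ₖ (1 : Matrix (Fin nβ) (Fin nβ) ℂ)) * Z.conjTranspose = r • Qγ⁻¹ := by
      calc Z * (Qα⁻¹ ⊗ₖ (1 : Matrix (Fin nβ) (Fin nβ) ℂ)) * Z.conjTranspose
          = (CFC.sqrt Qγ)⁻¹ * (Y * Y.conjTranspose) * (CFC.sqrt Qγ)⁻¹ := by
            rw [hYY, ← Matrix.mul_assoc, Matrix.mul_nonsing_inv_cancel_right _ _ hdγ,
              Matrix.nonsing_inv_mul_cancel_left _ _ hdγ]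
        _ = r • Qγ⁻¹ := by
            rw [hr, Matrix.mul_smul, Matrix.mul_one, Matrix.smul_mul,
              CQG.inv_sqrt_mul_inv_sqrt hQγ.posDef]
    -- Traces of `hZZ`, with both `Tr Q⁻¹` replaced by `Tr Q`.
    have htr : CQG.quantumDim Qα = r * CQG.quantumDim Qγ := by
      rw [CQG.quantumDim, CQG.quantumDim, ← hQα.trace_inv, ← hQγ.trace_inv,
        ← CQG.trace_rearrange (m := Fin nβ) (n := Fin nγ) Qα⁻¹ hVV, ← hZ, hZZ,
        Matrix.trace_smul, smul_eq_mul]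
    have hdim : CQG.quantumDim Qγ ≠ 0 := hQγ.posDef.trace_pos.ne'
    -- The factor `d_α / d_γ = r` cancels the `r⁻¹` in the projection.
    rw [htr, mul_div_cancel_right₀ _ hdim, hproj, Matrix.mul_smul, Matrix.smul_mul, smul_smul,
      mul_inv_cancel₀ hr0, one_smul, CQG.choiMatrix_cgMap, ← hZ]
    have hYZ' : (CFC.sqrt Qα ⊗ₖ (1 : Matrix (Fin nβ) (Fin nβ) ℂ)) *
        Y.conjTranspose = Z.conjTranspose * CFC.sqrt Qγ := by
      have h := congrArg Matrix.conjTranspose hYZ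
      rwa [Matrix.conjTranspose_mul, Matrix.conjTranspose_mul, Matrix.conjTranspose_kronecker,
        CQG.conjTranspose_sqrt, CQG.conjTranspose_sqrt, Matrix.conjTranspose_one] at h
    rw [← Matrix.mul_assoc, hYZ', Matrix.mul_assoc _ Y, hYZ]
    nth_rewrite 1 [← CQG.sqrt_mul_sqrt hQγ.posDef]
    simp only [Matrix.mul_assoc]
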